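/- Let $\mathbb K$ be $\mathbb R$ or $\mathbb C$ and let $n\ge 0$. A formal vector field is an $n$-tuple of formal power series in $\mathbb K[[x_1,\dots,x_n]]$; the Lie bracket of two formal vector fields is $[u,v]:=Dv\cdot u-Du\cdot v$, where $Du$, $Dv$ are the matrices of formal partial derivatives. Let $f$ be a formal vector field with $f(0)=0$, let $A=Df(0)$, and let $\lambda_1,\dots,\lambda_n\in\mathbb C$ be the eigenvalues of $A$, counted with algebraic multiplicity. Suppose that there are no nonnegative integers $m_1,\dots,m_n$ with $\sum_i m_i\ge 2$ and no $j\in\{1,\dots,n\}$ such that $\sum_i m_i\lambda_i-\lambda_j=0$. If $g$ is a formal vector field such that $[g,f]=\alpha f$ for some $\alpha\in\mathbb K[[x_1,\dots,x_n]]$, then there are $\beta\in\mathbb K[[x_1,\dots,x_n]]$ and a formal vector field $h$ with $[h,f]=0$ such that $g=h+\beta f$. -/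

import Mathlib

namespace FormalNF

/-- Formal power series `𝕂[[x₁, …, xₙ]]`. -/
abbrev FSeries (𝕂 : Type*) (n : ℕ) : Type _ := MvPowerSeries (Fin n) 𝕂

/-- Formal vector fields: `n`-tuples of formal power series in `n` variables, a module over the
formal power series. -/
abbrev FVectorField (𝕂 : Type*) (n : ℕ) : Type _ := Fin n → FSeries 𝕂 n

/-- The Lie bracket `[f, g] = Dg · f - Df · g`. -/
noncomputable def lieBracket {𝕂 : Type*} [Field 𝕂] {n : ℕ} (f g : FVectorField 𝕂 n) :
    FVectorField 𝕂 n :=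
  fun i => ∑ j, MvPowerSeries.pderiv 𝕂 j (g i) * f j - ∑ j, MvPowerSeries.pderiv 𝕂 j (f i) * g j

/-- The Jacobian matrix `Df(0)`, with entries `(∂fᵢ/∂xⱼ)(0)`. -/
noncomputable def jacobianAtZero {𝕂 : Type*} [Field 𝕂] {n : ℕ} (f : FVectorField 𝕂 n) :
    Matrix (Fin n) (Fin n) 𝕂 :=
  Matrix.of fun i j => MvPowerSeries.constantCoeff (MvPowerSeries.pderiv 𝕂 j (f i))

/-- The embedding of `𝕂` (that is, `ℝ` or `ℂ`) into `ℂ`. -/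
noncomputable def toComplexHom (𝕂 : Type*) [RCLike 𝕂] : 𝕂 →+* ℂ where
  toFun x := ⟨RCLike.re x, RCLike.im x⟩
  map_one' := by apply Complex.ext <;> simp
  map_zero' := by apply Complex.ext <;> simp
  map_add' x y := by apply Complex.ext <;> simp
  map_mul' x y := by apply Complex.ext <;> simp [RCLike.mul_re, RCLike.mul_im]

/-- `lam 0, …, lam (n-1)` are the complex eigenvalues of `A`, listed with algebraic
multiplicity. -/
def IsEigenvalueList {𝕂 : Type*} [RCLike 𝕂] {n : ℕ} (A : Matrix (Fin n) (Fin n) 𝕂)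
    (lam : Fin n → ℂ) : Prop :=
  (A.map (toComplexHom 𝕂)).charpoly.roots = Finset.univ.val.map lam

/-- No resonance `∑ mᵢ λᵢ - λⱼ = 0` with nonnegative integers `mᵢ` and `∑ mᵢ ≥ 2`. -/
def NonResonant {n : ℕ} (lam : Fin n → ℂ) : Prop :=
  ∀ (m : Fin n → ℕ) (j : Fin n), 2 ≤ ∑ i, m i → (∑ i, (m i : ℂ) * lam i) - lam j ≠ 0

end FormalNF

namespace FormalNF

open MvPowerSeries Finsupp

section Filtration

variable {σ K : Type*} [Field K]

/-- The power series all of whose coefficients of degree less than `k` vanish. -/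
def orderGE (σ K : Type*) [Field K] (k : ℕ) : Submodule K (MvPowerSeries σ K) where
  carrier := {φ | ∀ d : σ →₀ ℕ, degree d < k → coeff d φ = 0}
  add_mem' hφ hψ d hd := by simp [hφ d hd, hψ d hd]
  zero_mem' d _ := by simp
  smul_mem' c φ hφ d hd := by simp [hφ d hd]

theorem mem_orderGE_iff_le_order {k : ℕ} {φ : MvPowerSeries σ K} :
    φ ∈ orderGE σ K k ↔ (k : ℕ∞) ≤ φ.order :=
  ⟨fun h => nat_le_order h, fun h _ hd => coeff_of_lt_order (lt_of_lt_of_le (by exact_mod_cast hd) h)⟩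

theorem orderGE_anti {k l : ℕ} (h : k ≤ l) : orderGE σ K l ≤ orderGE σ K k :=
  fun _ hφ d hd => hφ d (hd.trans_le h)

theorem mem_orderGE_zero (φ : MvPowerSeries σ K) : φ ∈ orderGE σ K 0 :=
  fun _ hd => absurd hd (Nat.not_lt_zero _)

theorem mem_orderGE_one {φ : MvPowerSeries σ K} :
    φ ∈ orderGE σ K 1 ↔ constantCoeff φ = 0 := by
  rw [mem_orderGE_iff_le_order, Nat.cast_one, one_le_order_iff_constCoeff_eq_zero]

theorem mul_mem_orderGE {k l : ℕ} {φ ψ : MvPowerSeries σ K}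
    (hφ : φ ∈ orderGE σ K k) (hψ : ψ ∈ orderGE σ K l) : φ * ψ ∈ orderGE σ K (k + l) := by
  rw [mem_orderGE_iff_le_order] at *
  push_cast
  exact (add_le_add hφ hψ).trans le_order_mul

theorem pderiv_mem_orderGE {k : ℕ} (i : σ) {φ : MvPowerSeries σ K}
    (hφ : φ ∈ orderGE σ K (k + 1)) : pderiv K i φ ∈ orderGE σ K k := by
  intro d hd
  rw [coeff_pderiv, hφ _ (by simpa using hd), zero_mul]

/-- A series of order at least `k` is, modulo higher order, a combination of monomials of
degree `k`. -/
theorem orderGE_le_span_monomial_sup [Fintype σ] (k : ℕ) :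
    orderGE σ K k ≤
      Submodule.span K ((fun d : σ →₀ ℕ => monomial d (1 : K)) '' {d | degree d = k}) ⊔
        orderGE σ K (k + 1) := by
  classical
  intro φ hφ
  set p : MvPowerSeries σ K :=
    ∑ d ∈ Finset.univ.finsuppAntidiag k, coeff d φ • monomial d (1 : K) with hp
  have hpmem : p ∈ Submodule.span K
      ((fun d : σ →₀ ℕ => monomial d (1 : K)) '' {d | degree d = k}) := by
    refine Submodule.sum_mem _ fun d hd => Submodule.smul_mem _ _ (Submodule.subset_span ⟨d, ?_, rfl⟩)
    rw [Finset.mem_finsuppAntidiag] at hd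
    rw [Set.mem_ofPred_eq, degree_eq_sum]
    exact hd.1
  have hsub : φ - p ∈ orderGE σ K (k + 1) := by
    intro d hd
    have hcoeff : coeff d p = if degree d = k then coeff d φ else 0 := by
      simp only [hp, map_sum, map_smul, coeff_monomial, smul_eq_mul, mul_ite, mul_one, mul_zero]
      rw [Finset.sum_ite_eq]
      simp [Finset.mem_finsuppAntidiag, degree_eq_sum]
    rw [map_sub, hcoeff]
    split_ifs with h
    · simp
    · simp [hφ d (by omega)]
  rw [← add_sub_cancel p φ]
  exact Submodule.add_mem_sup hpmem hsub

end Filtration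

section LieDerivative

variable {σ K : Type*} [Field K] [Fintype σ]

/-- The derivation `φ ↦ Dφ · f` of the power series ring along the vector field `f`. -/
noncomputable def lieDerivative (f : σ → MvPowerSeries σ K) :
    Derivation K (MvPowerSeries σ K) (MvPowerSeries σ K) :=
  ∑ j, f j • pderiv K j

theorem lieDerivative_apply (f : σ → MvPowerSeries σ K) (φ : MvPowerSeries σ K) :
    lieDerivative f φ = ∑ j, pderiv K j φ * f j := by
  rw [lieDerivative, ← Derivation.coeFnAddMonoidHom_apply, map_sum, Finset.sum_apply]
  exact Finset.sum_congr rfl fun j _ => by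
    simp [Derivation.coeFnAddMonoidHom_apply, mul_comm]

theorem lieDerivative_mem_orderGE {f : σ → MvPowerSeries σ K} (hf : ∀ j, f j ∈ orderGE σ K 1)
    {k : ℕ} {φ : MvPowerSeries σ K} (hφ : φ ∈ orderGE σ K k) :
    lieDerivative f φ ∈ orderGE σ K k := by
  rw [lieDerivative_apply]
  refine Submodule.sum_mem _ fun j _ => ?_
  cases k with
  | zero => exact mem_orderGE_zero _
  | succ k => exact mul_mem_orderGE (pderiv_mem_orderGE j hφ) (hf j)

end LieDerivative

section GenEigenform

variable {σ K : Type*} [Field K]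

/-- `φ` has order at least `k` and its leading form of degree `k` is annihilated by the `N`-th
power of `D - c`. -/
def IsGenEigenform (D : Derivation K (MvPowerSeries σ K) (MvPowerSeries σ K)) (c : K) (k : ℕ) :
    ℕ → MvPowerSeries σ K → Prop
  | 0, φ => φ ∈ orderGE σ K (k + 1)
  | N + 1, φ => φ ∈ orderGE σ K k ∧ IsGenEigenform D c k N (D φ - c • φ)

namespace IsGenEigenform

variable {f : σ → MvPowerSeries σ K} {c c' : K} {k l N M : ℕ} {φ ψ : MvPowerSeries σ K}

theorem mem {D : Derivation K (MvPowerSeries σ K) (MvPowerSeries σ K)}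
    (h : IsGenEigenform D c k N φ) : φ ∈ orderGE σ K k := by
  cases N with
  | zero => exact orderGE_anti (Nat.le_succ k) h
  | succ N => exact h.1

theorem of_mem [Fintype σ] (hf : ∀ j, f j ∈ orderGE σ K 1) (h : φ ∈ orderGE σ K (k + 1)) :
    IsGenEigenform (lieDerivative f) c k N φ := by
  induction N generalizing φ with
  | zero => exact h
  | succ N ih =>
    exact ⟨orderGE_anti (Nat.le_succ k) h,
      ih (sub_mem (lieDerivative_mem_orderGE hf h) (Submodule.smul_mem _ _ h))⟩

theorem add {D : Derivation K (MvPowerSeries σ K) (MvPowerSeries σ K)}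
    (hφ : IsGenEigenform D c k N φ) (hψ : IsGenEigenform D c k N ψ) :
    IsGenEigenform D c k N (φ + ψ) := by
  induction N generalizing φ ψ with
  | zero => exact add_mem (S := Submodule K (MvPowerSeries σ K)) hφ hψ
  | succ N ih =>
    refine ⟨add_mem hφ.1 hψ.1, ?_⟩
    have := ih hφ.2 hψ.2
    rwa [sub_add_sub_comm, ← map_add, ← smul_add] at this

theorem mul [Fintype σ] (hf : ∀ j, f j ∈ orderGE σ K 1)
    (hφ : IsGenEigenform (lieDerivative f) c k N φ)
    (hψ : IsGenEigenform (lieDerivative f) c' l M ψ) :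
    IsGenEigenform (lieDerivative f) (c + c') (k + l) (N + M) (φ * ψ) := by
  induction hs : N + M generalizing N M φ ψ with
  | zero =>
    obtain ⟨rfl, rfl⟩ : N = 0 ∧ M = 0 := by omega
    have h1 : φ * ψ ∈ orderGE σ K (k + 1 + l) := mul_mem_orderGE hφ hψ.mem
    exact orderGE_anti (by omega) h1
  | succ s ih =>
    rcases N with _ | N
    · refine of_mem hf ?_
      have h1 : φ * ψ ∈ orderGE σ K (k + 1 + l) := mul_mem_orderGE hφ hψ.mem
      exact orderGE_anti (by omega) h1
    rcases M with _ | M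
    · refine of_mem hf ?_
      have h1 : φ * ψ ∈ orderGE σ K (k + (l + 1)) := mul_mem_orderGE hφ.mem hψ
      exact orderGE_anti (by omega) h1
    refine ⟨mul_mem_orderGE hφ.1 hψ.1, ?_⟩
    have h1 := ih hφ.2 hψ (by omega)
    have h2 := ih hφ hψ.2 (by omega)
    have h3 := h1.add h2
    convert h3 using 1
    rw [Derivation.leibniz]
    simp only [smul_eq_mul, smul_eq_C_mul, map_add]
    ring

/-- A generalized eigenform with nonzero eigenvalue is in the image of `D` to leading order. -/
theorem exists_sub_mem {D : Derivation K (MvPowerSeries σ K) (MvPowerSeries σ K)} (hc : c ≠ 0)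
    (h : IsGenEigenform D c k N φ) :
    ∃ b ∈ orderGE σ K k, φ - D b ∈ orderGE σ K (k + 1) := by
  induction N generalizing φ with
  | zero => exact ⟨0, zero_mem _, by rw [map_zero, sub_zero]; exact h⟩
  | succ N ih =>
    obtain ⟨b, hb, hb'⟩ := ih h.2
    refine ⟨c⁻¹ • (φ - b), Submodule.smul_mem _ _ (sub_mem h.1 hb), ?_⟩
    have : φ - D (c⁻¹ • (φ - b)) = -(c⁻¹ • (D φ - c • φ - D b)) := by
      rw [Derivation.map_smul, map_sub, smul_sub, smul_sub, smul_sub, smul_smul,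
        inv_mul_cancel₀ hc, one_smul]
      abel
    rw [this]
    exact neg_mem (Submodule.smul_mem _ _ hb')

end IsGenEigenform

end GenEigenform

theorem exists_eq_single_add {σ : Type*} {d : σ →₀ ℕ} {k : ℕ} (hd : degree d = k + 1) :
    ∃ (i : σ) (e : σ →₀ ℕ), degree e = k ∧ d = single i 1 + e := by
  obtain ⟨i, hi⟩ : ∃ i, d i ≠ 0 := by
    by_contra! h
    obtain rfl : d = 0 := Finsupp.ext h
    simp at hd
  have hle : single i 1 ≤ d := Finsupp.single_le_iff.2 (Nat.one_le_iff_ne_zero.2 hi)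
  have heq : d = single i 1 + (d - single i 1) := (add_tsub_cancel_of_le hle).symm
  refine ⟨i, _, ?_, heq⟩
  rw [heq, map_add, degree_single] at hd
  omega

theorem X_mem_orderGE {σ K : Type*} [Field K] (i : σ) :
    (X i : MvPowerSeries σ K) ∈ orderGE σ K 1 :=
  mem_orderGE_one.2 (by simp)

section Surjectivity

variable {σ K : Type*} [Field K] [Fintype σ]

/-- Successive approximation: if the Lie derivative is onto in every positive degree, to leading
order, then it is onto the series without constant term. -/
theorem exists_lieDerivative_eq {f : σ → MvPowerSeries σ K} (hf : ∀ j, f j ∈ orderGE σ K 1)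
    (hstep : ∀ k : ℕ, k ≠ 0 → ∀ φ ∈ orderGE σ K k,
      ∃ b ∈ orderGE σ K k, φ - lieDerivative f b ∈ orderGE σ K (k + 1))
    {α : MvPowerSeries σ K} (hα : constantCoeff α = 0) : ∃ β, lieDerivative f β = α := by
  choose! b hb hb' using fun k : ℕ => hstep (k + 1) k.succ_ne_zero
  let r : ℕ → MvPowerSeries σ K := fun k => Nat.rec α (fun k γ => γ - lieDerivative f (b k γ)) k
  have hr (k : ℕ) : r k ∈ orderGE σ K (k + 1) := by
    induction k with
    | zero => exact mem_orderGE_one.2 hα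
    | succ k ih => exact hb' k _ ih
  have hsum (k : ℕ) : lieDerivative f (∑ i ∈ Finset.range k, b i (r i)) = α - r k := by
    induction k with
    | zero => simp [r]
    | succ k ih =>
      rw [Finset.sum_range_succ, map_add, ih]
      change _ = α - (r k - lieDerivative f (b k (r k)))
      abel
  let β : MvPowerSeries σ K := fun d => coeff d (∑ i ∈ Finset.range (degree d), b i (r i))
  have hβ (k : ℕ) : β - ∑ i ∈ Finset.range k, b i (r i) ∈ orderGE σ K (k + 1) := by
    intro d hd
    rw [map_sub, sub_eq_zero]
    change coeff d (∑ i ∈ Finset.range (degree d), b i (r i)) = _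
    rw [map_sum, map_sum]
    refine Finset.sum_subset (Finset.range_mono (by omega)) fun i _ hi => ?_
    rw [Finset.mem_range, not_lt] at hi
    exact hb i _ (hr i) d (by omega)
  refine ⟨β, ?_⟩
  ext d
  have h1 := lieDerivative_mem_orderGE hf (hβ (degree d)) d (by omega)
  rw [map_sub, hsum, map_sub, map_sub, hr (degree d) d (by omega), sub_zero, sub_eq_zero] at h1
  exact h1

/-- The Jacobian matrix at the origin of a family of power series in `σ` variables. -/
noncomputable def linearPart (f : σ → MvPowerSeries σ K) : Matrix σ σ K :=
  Matrix.of fun i j => constantCoeff (pderiv K j (f i))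

/-- The linear form with given coefficients, as a power series. -/
noncomputable def linForm (σ K : Type*) [Field K] [Fintype σ] :
    (σ → K) →ₗ[K] MvPowerSeries σ K :=
  Fintype.linearCombination K (fun i : σ => (X i : MvPowerSeries σ K))

theorem linForm_apply (v : σ → K) : linForm σ K v = ∑ i, v i • (X i : MvPowerSeries σ K) := rfl

theorem linForm_mem_orderGE (v : σ → K) : linForm σ K v ∈ orderGE σ K 1 :=
  Submodule.sum_mem _ fun i _ => Submodule.smul_mem _ _ (X_mem_orderGE i)

theorem sub_linForm_mem_orderGE {φ : MvPowerSeries σ K} (hφ : φ ∈ orderGE σ K 1) :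
    φ - linForm σ K (fun j => constantCoeff (pderiv K j φ)) ∈ orderGE σ K 2 := by
  classical
  intro d hd
  rw [map_sub, sub_eq_zero, linForm_apply]
  simp only [map_sum, map_smul, coeff_X, smul_eq_mul, ← coeff_zero_eq_constantCoeff_apply,
    coeff_pderiv]
  rcases Nat.lt_or_ge (degree d) 1 with h | h
  · rw [hφ d h]
    refine (Finset.sum_eq_zero fun i _ => ?_).symm
    rw [if_neg, mul_zero]
    rintro rfl
    simp at h
  · obtain ⟨i, rfl⟩ : ∃ i, d = single i 1 := by
      obtain ⟨i, e, he, rfl⟩ := exists_eq_single_add (d := d) (k := 0) (by omega)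
      rw [degree_eq_zero_iff] at he
      exact ⟨i, by rw [he, add_zero]⟩
    rw [Finset.sum_eq_single i]
    · simp
    · intro j _ hj
      rw [if_neg, mul_zero]
      intro h'
      exact hj (Finsupp.single_left_injective one_ne_zero h').symm
    · simp

theorem lieDerivative_X (f : σ → MvPowerSeries σ K) (i : σ) :
    lieDerivative f (X i) = f i := by
  rw [lieDerivative_apply, Finset.sum_eq_single i]
  · simp
  · intro j _ hj
    rw [pderiv_X_of_ne hj.symm, zero_mul]
  · simp

variable [DecidableEq σ]

theorem lieDerivative_linForm_sub_mem {f : σ → MvPowerSeries σ K}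
    (hf : ∀ j, f j ∈ orderGE σ K 1) (v : σ → K) :
    lieDerivative f (linForm σ K v) - linForm σ K (Matrix.toLin' (linearPart f).transpose v) ∈
      orderGE σ K 2 := by
  have h1 : lieDerivative f (linForm σ K v) = ∑ i, v i • f i := by
    simp [linForm_apply, lieDerivative_X]
  have h2 : Matrix.toLin' (linearPart f).transpose v =
      ∑ i, v i • fun j => constantCoeff (pderiv K j (f i)) := by
    ext j
    simp [Matrix.mulVec, dotProduct, linearPart, mul_comm]
  rw [h1, h2, map_sum, ← Finset.sum_sub_distrib]
  refine Submodule.sum_mem _ fun i _ => ?_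
  rw [map_smul, ← smul_sub]
  exact Submodule.smul_mem _ _ (sub_linForm_mem_orderGE (hf i))

theorem isGenEigenform_linForm {f : σ → MvPowerSeries σ K} (hf : ∀ j, f j ∈ orderGE σ K 1)
    {c : K} {N : ℕ} {v : σ → K}
    (hv : ((Matrix.toLin' (linearPart f).transpose - c • (1 : Module.End K (σ → K))) ^ N) v = 0) :
    IsGenEigenform (lieDerivative f) c 1 N (linForm σ K v) := by
  induction N generalizing v with
  | zero =>
    obtain rfl : v = 0 := by simpa using hv
    rw [map_zero]
    exact zero_mem (orderGE σ K 2)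
  | succ N ih =>
    refine ⟨linForm_mem_orderGE v, ?_⟩
    rw [pow_succ, Module.End.mul_apply] at hv
    have h := (ih hv).add
      (IsGenEigenform.of_mem hf (lieDerivative_linForm_sub_mem hf v))
    convert h using 1
    simp

/-- The span of the generalized eigenforms of degree `k` whose eigenvalue is a sum of `k`
eigenvalues of the linear part of `f`. -/
def genEigenformSpan (f : σ → MvPowerSeries σ K) (k : ℕ) : Submodule K (MvPowerSeries σ K) :=
  Submodule.span K {φ | ∃ s : Multiset K, s.card = k ∧
    (∀ μ ∈ s, Module.End.HasEigenvalue (Matrix.toLin' (linearPart f).transpose) μ) ∧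
    ∃ N, IsGenEigenform (lieDerivative f) s.sum k N φ}

theorem mul_mem_genEigenformSpan {f : σ → MvPowerSeries σ K} (hf : ∀ j, f j ∈ orderGE σ K 1)
    {k l : ℕ} {φ ψ : MvPowerSeries σ K} (hφ : φ ∈ genEigenformSpan f k)
    (hψ : ψ ∈ genEigenformSpan f l) : φ * ψ ∈ genEigenformSpan f (k + l) := by
  have h := Submodule.mul_mem_mul hφ hψ
  rw [genEigenformSpan, genEigenformSpan, Submodule.span_mul_span] at h
  refine Submodule.span_mono ?_ h
  rintro _ ⟨φ, ⟨s, hs, hs', N, hN⟩, ψ, ⟨t, ht, ht', M, hM⟩, rfl⟩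
  refine ⟨s + t, by simp [hs, ht], ?_, N + M, ?_⟩
  · intro μ hμ
    rcases Multiset.mem_add.1 hμ with h | h
    exacts [hs' μ h, ht' μ h]
  · rw [Multiset.sum_add]
    exact hN.mul hf hM

theorem linForm_mem_genEigenformSpan [IsAlgClosed K] {f : σ → MvPowerSeries σ K}
    (hf : ∀ j, f j ∈ orderGE σ K 1) (v : σ → K) : linForm σ K v ∈ genEigenformSpan f 1 := by
  set T : Module.End K (σ → K) := Matrix.toLin' (linearPart f).transpose with hT
  have htop : v ∈ ⨆ μ : K, T.maxGenEigenspace μ := by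
    rw [Module.End.iSup_maxGenEigenspace_eq_top]
    trivial
  rw [← Submodule.mem_comap]
  refine (iSup_le fun μ => ?_ : ⨆ μ : K, T.maxGenEigenspace μ ≤ _) htop
  intro w hw
  rw [Submodule.mem_comap]
  by_cases hw0 : w = 0
  · rw [hw0, map_zero]
    exact zero_mem _
  obtain ⟨N, hN⟩ := (Module.End.mem_maxGenEigenspace _ _ _).1 hw
  have hμ : T.HasEigenvalue μ := by
    refine Module.End.hasEigenvalue_of_hasGenEigenvalue (k := N) ?_
    rw [Module.End.HasGenEigenvalue, Module.End.HasUnifEigenvalue]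
    intro hbot
    apply hw0
    rw [← Submodule.mem_bot K, ← hbot]
    exact Module.End.mem_genEigenspace_nat.2 hN
  refine Submodule.subset_span ⟨{μ}, by simp, by simpa using hμ, N, ?_⟩
  rw [Multiset.sum_singleton]
  exact isGenEigenform_linForm hf hN

theorem exists_hasEigenvalue [IsAlgClosed K] [Nonempty σ] (f : σ → MvPowerSeries σ K) :
    ∃ μ, Module.End.HasEigenvalue (Matrix.toLin' (linearPart f).transpose) μ :=
  Module.End.exists_eigenvalue _

theorem one_mem_genEigenformSpan {f : σ → MvPowerSeries σ K} :
    (1 : MvPowerSeries σ K) ∈ genEigenformSpan f 0 := by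
  refine Submodule.subset_span ⟨0, by simp, by simp, 1, mem_orderGE_zero _, ?_⟩
  rw [Derivation.map_one_eq_zero, Multiset.sum_zero, zero_smul, sub_zero]
  exact zero_mem (orderGE σ K 1)

theorem monomial_mem_genEigenformSpan [IsAlgClosed K] {f : σ → MvPowerSeries σ K}
    (hf : ∀ j, f j ∈ orderGE σ K 1) (d : σ →₀ ℕ) :
    monomial d (1 : K) ∈ genEigenformSpan f (degree d) := by
  have hX (i : σ) : (X i : MvPowerSeries σ K) ∈ genEigenformSpan f 1 := by
    have h := linForm_mem_genEigenformSpan hf (Pi.single i 1)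
    rwa [linForm, Fintype.linearCombination_apply_single, one_smul] at h
  induction hk : degree d generalizing d with
  | zero =>
    obtain rfl := (degree_eq_zero_iff d).1 hk
    exact one_mem_genEigenformSpan
  | succ k ih =>
    obtain ⟨i, e, he, rfl⟩ := exists_eq_single_add hk
    have h := mul_mem_genEigenformSpan hf (hX i) (ih e he)
    rwa [X_def, monomial_mul_monomial, one_mul, add_comm 1 k] at h

theorem orderGE_le_genEigenformSpan [IsAlgClosed K] [Nonempty σ] {f : σ → MvPowerSeries σ K}
    (hf : ∀ j, f j ∈ orderGE σ K 1) (k : ℕ) : orderGE σ K k ≤ genEigenformSpan f k := by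
  refine (orderGE_le_span_monomial_sup k).trans (sup_le (Submodule.span_le.2 ?_) fun φ hφ => ?_)
  · rintro _ ⟨d, rfl, rfl⟩
    exact monomial_mem_genEigenformSpan hf d
  · obtain ⟨μ, hμ⟩ := exists_hasEigenvalue f
    refine Submodule.subset_span ⟨Multiset.replicate k μ, by simp, ?_, 0, hφ⟩
    intro ν hν
    rwa [Multiset.eq_of_mem_replicate hν]

/-- If no nonempty sum of eigenvalues of the linear part vanishes, the Lie derivative is onto in
every positive degree, to leading order. -/
theorem exists_sub_lieDerivative_mem [IsAlgClosed K] [Nonempty σ] {f : σ → MvPowerSeries σ K}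
    (hf : ∀ j, f j ∈ orderGE σ K 1)
    (hev : ∀ s : Multiset K, s ≠ 0 →
      (∀ μ ∈ s, Module.End.HasEigenvalue (Matrix.toLin' (linearPart f).transpose) μ) → s.sum ≠ 0)
    {k : ℕ} (hk : k ≠ 0) {φ : MvPowerSeries σ K} (hφ : φ ∈ orderGE σ K k) :
    ∃ b ∈ orderGE σ K k, φ - lieDerivative f b ∈ orderGE σ K (k + 1) := by
  have h := orderGE_le_genEigenformSpan hf k hφ
  clear hφ
  induction h using Submodule.span_induction with
  | mem φ h =>
    obtain ⟨s, hs, hs', N, hN⟩ := h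
    refine hN.exists_sub_mem (hev s ?_ hs')
    rintro rfl
    exact hk (by simpa using hs.symm)
  | zero => exact ⟨0, zero_mem _, by simp⟩
  | add φ ψ _ _ ih₁ ih₂ =>
    obtain ⟨a, ha, ha'⟩ := ih₁
    obtain ⟨b, hb, hb'⟩ := ih₂
    refine ⟨a + b, add_mem ha hb, ?_⟩
    rw [map_add, add_sub_add_comm]
    exact add_mem ha' hb'
  | smul c φ _ ih =>
    obtain ⟨a, ha, ha'⟩ := ih
    refine ⟨c • a, Submodule.smul_mem _ _ ha, ?_⟩
    rw [Derivation.map_smul, ← smul_sub]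
    exact Submodule.smul_mem _ _ ha'

end Surjectivity

section Descent

variable {σ K L : Type*} [Field K] [Field L] [Algebra K L]

/-- Apply a linear functional to every coefficient. -/
def coeffwise (r : L →ₗ[K] K) (φ : MvPowerSeries σ L) : MvPowerSeries σ K :=
  fun d => r (coeff d φ)

theorem coeff_coeffwise (r : L →ₗ[K] K) (φ : MvPowerSeries σ L) (d : σ →₀ ℕ) :
    coeff d (coeffwise r φ) = r (coeff d φ) := rfl

theorem coeffwise_sum {ι : Type*} (r : L →ₗ[K] K) (s : Finset ι) (φ : ι → MvPowerSeries σ L) :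
    coeffwise r (∑ i ∈ s, φ i) = ∑ i ∈ s, coeffwise r (φ i) := by
  ext d
  simp [coeff_coeffwise]

theorem coeffwise_mul_map (r : L →ₗ[K] K) (φ : MvPowerSeries σ L) (ψ : MvPowerSeries σ K) :
    coeffwise r (φ * map (algebraMap K L) ψ) = coeffwise r φ * ψ := by
  classical
  ext d
  simp only [coeff_coeffwise, coeff_mul, map_sum, coeff_map]
  refine Finset.sum_congr rfl fun p _ => ?_
  rw [mul_comm, ← Algebra.smul_def, map_smul, smul_eq_mul, mul_comm]

theorem coeffwise_pderiv (r : L →ₗ[K] K) (i : σ) (φ : MvPowerSeries σ L) :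
    coeffwise r (pderiv L i φ) = pderiv K i (coeffwise r φ) := by
  ext d
  rw [coeff_coeffwise, coeff_pderiv, coeff_pderiv, coeff_coeffwise]
  have h : ((d i : L) + 1) = algebraMap K L (d i + 1) := by simp
  rw [h, mul_comm, ← Algebra.smul_def, map_smul, smul_eq_mul, mul_comm]

theorem map_pderiv (i : σ) (φ : MvPowerSeries σ K) :
    map (algebraMap K L) (pderiv K i φ) = pderiv L i (map (algebraMap K L) φ) := by
  ext d
  simp [coeff_pderiv]

/-- Solvability of `lieDerivative f β = α` descends along a field extension. -/
theorem exists_lieDerivative_eq_of_map [Fintype σ] {f : σ → MvPowerSeries σ K}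
    {α : MvPowerSeries σ K}
    (h : ∃ β, lieDerivative (fun i => map (algebraMap K L) (f i)) β = map (algebraMap K L) α) :
    ∃ β, lieDerivative f β = α := by
  obtain ⟨β, hβ⟩ := h
  obtain ⟨r, hr⟩ := (Algebra.linearMap K L).exists_leftInverse_of_injective
    (LinearMap.ker_eq_bot.2 (algebraMap K L).injective)
  refine ⟨coeffwise r β, ?_⟩
  have h := congrArg (coeffwise r) hβ
  rw [lieDerivative_apply, coeffwise_sum] at h
  simp only [coeffwise_mul_map, coeffwise_pderiv] at h
  rw [lieDerivative_apply, h]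
  ext d
  rw [coeff_coeffwise, coeff_map]
  exact LinearMap.congr_fun hr (coeff d α)

end Descent

section Bracket

variable {K : Type*} [Field K] {n : ℕ}

theorem lieBracket_apply (u v : FVectorField K n) (i : Fin n) :
    lieBracket u v i = lieDerivative u (v i) - lieDerivative v (u i) := by
  rw [lieBracket, lieDerivative_apply, lieDerivative_apply]

/-- `[g - βf, f] = [g, f] + L_f(β) f`. -/
theorem lieBracket_sub_smul (f g : FVectorField K n) (β : FSeries K n) :
    lieBracket (g - β • f) f = lieBracket g f + lieDerivative f β • f := by
  ext1 i
  have h : lieDerivative (g - β • f) (f i) = lieDerivative g (f i) - β * lieDerivative f (f i) := by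
    simp only [lieDerivative_apply, Finset.mul_sum, ← Finset.sum_sub_distrib]
    exact Finset.sum_congr rfl fun j _ => by simp; ring
  simp only [Pi.add_apply, Pi.smul_apply, lieBracket_apply, h, Pi.sub_apply, map_sub,
    smul_eq_mul, Derivation.leibniz]
  ring

theorem constantCoeff_eq_zero_of_lieBracket_eq_smul [CharZero K] [NeZero n]
    {f g : FVectorField K n} {α : FSeries K n} (hf0 : ∀ i, constantCoeff (f i) = 0)
    (hdet : (jacobianAtZero f).det ≠ 0) (hg : lieBracket g f = α • f) :
    constantCoeff α = 0 := by
  set A := jacobianAtZero f with hA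
  set B := jacobianAtZero g with hB
  have hAu : IsUnit A.det := isUnit_iff_ne_zero.2 hdet
  have hg0 : ∀ i, constantCoeff (g i) = 0 := by
    have h : A.mulVec (fun j => constantCoeff (g j)) = 0 := by
      ext i
      have h := congrArg constantCoeff (congrFun hg i)
      simpa [lieBracket, hf0, Matrix.mulVec, dotProduct, hA, jacobianAtZero] using h
    exact congrFun (Matrix.eq_zero_of_mulVec_eq_zero hdet h)
  have hcomm : A * B - B * A = constantCoeff α • A := by
    ext i k
    have h := congrArg (fun φ => constantCoeff (pderiv K k φ)) (congrFun hg i)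
    simpa [lieBracket, hf0, hg0, Matrix.mul_apply, hA, hB, jacobianAtZero] using h
  have htr := congrArg (fun M => (A⁻¹ * M).trace) hcomm
  simp only [mul_sub, Matrix.trace_sub, Matrix.mul_smul, Matrix.trace_smul] at htr
  rw [Matrix.nonsing_inv_mul_cancel_left _ _ hAu, Matrix.trace_mul_comm A⁻¹ (B * A),
    Matrix.mul_nonsing_inv_cancel_right _ _ hAu, sub_self, Matrix.nonsing_inv_mul _ hAu,
    Matrix.trace_one, Fintype.card_fin, smul_eq_mul] at htr
  exact (mul_eq_zero.1 htr.symm).resolve_right (NeZero.ne _)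

end Bracket

section NonResonance

theorem NonResonant.sum_ne_zero {n : ℕ} {lam : Fin n → ℂ} (h : NonResonant lam)
    {m : Fin n → ℕ} (hm : m ≠ 0) : ∑ i, (m i : ℂ) * lam i ≠ 0 := by
  classical
  obtain ⟨j, hj⟩ := Function.ne_iff.1 hm
  have hj' : 1 ≤ ∑ i, m i :=
    (Nat.one_le_iff_ne_zero.2 hj).trans (Finset.single_le_sum (fun _ _ => Nat.zero_le _)
      (Finset.mem_univ j))
  have := h (m + Pi.single j 1) j (by simp [Finset.sum_add_distrib]; omega)
  simpa [add_mul, Finset.sum_add_distrib, Pi.single_apply] using this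

theorem NonResonant.multiset_sum_ne_zero {n : ℕ} {lam : Fin n → ℂ} (h : NonResonant lam)
    {s : Multiset ℂ} (hs : s ≠ 0) (hmem : ∀ μ ∈ s, ∃ i, lam i = μ) : s.sum ≠ 0 := by
  classical
  obtain ⟨t, rfl⟩ : ∃ t : Multiset (Fin n), t.map lam = s := by
    clear hs
    induction s using Multiset.induction with
    | empty => exact ⟨0, rfl⟩
    | cons μ s ih =>
      obtain ⟨t, rfl⟩ := ih fun ν hν => hmem ν (Multiset.mem_cons_of_mem hν)
      obtain ⟨i, rfl⟩ := hmem μ (Multiset.mem_cons_self _ _)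
      exact ⟨i ::ₘ t, by simp⟩
  have hsum : (t.map lam).sum = ∑ i, (t.count i : ℂ) * lam i := by
    rw [Finset.sum_multiset_map_count]
    simp only [nsmul_eq_mul]
    refine Finset.sum_subset (Finset.subset_univ _) fun i _ hi => ?_
    rw [Multiset.mem_toFinset] at hi
    simp [Multiset.count_eq_zero_of_notMem hi]
  rw [hsum]
  refine h.sum_ne_zero (m := fun i => t.count i) fun h0 => hs ?_
  rw [Multiset.map_eq_zero]
  exact Multiset.ext.2 fun i => by simpa using congrFun h0 i

theorem IsEigenvalueList.det_ne_zero {𝕂 : Type*} [RCLike 𝕂] {n : ℕ}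
    {A : Matrix (Fin n) (Fin n) 𝕂} {lam : Fin n → ℂ} (hlam : IsEigenvalueList A lam)
    (hres : NonResonant lam) : A.det ≠ 0 := by
  classical
  intro h0
  have h1 : (A.map (toComplexHom 𝕂)).det = 0 := by
    rw [← RingHom.mapMatrix_apply, ← RingHom.map_det, h0, map_zero]
  rw [Matrix.det_eq_prod_roots_charpoly, hlam, Multiset.prod_eq_zero_iff] at h1
  obtain ⟨i, -, hi⟩ := Multiset.mem_map.1 h1
  refine hres.sum_ne_zero (m := Pi.single i 1) (by simp) ?_
  simp [Pi.single_apply, hi]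

theorem IsEigenvalueList.exists_eq_of_hasEigenvalue {𝕂 : Type*} [RCLike 𝕂] {n : ℕ}
    {A : Matrix (Fin n) (Fin n) 𝕂} {lam : Fin n → ℂ} (hlam : IsEigenvalueList A lam) {μ : ℂ}
    (hμ : Module.End.HasEigenvalue (Matrix.toLin' (A.map (toComplexHom 𝕂)).transpose) μ) :
    ∃ i, lam i = μ := by
  rw [Module.End.hasEigenvalue_iff_isRoot_charpoly, Matrix.charpoly_toLin',
    Matrix.charpoly_transpose, ← Polynomial.mem_roots (Matrix.charpoly_monic _).ne_zero, hlam] at hμ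
  simpa using hμ

/-- For a vector field with nonresonant linear part, the Lie derivative is onto the series without
constant term. -/
theorem exists_lieDerivative_eq_of_nonResonant {𝕂 : Type*} [RCLike 𝕂] {n : ℕ} [NeZero n]
    {f : FVectorField 𝕂 n} (hf0 : ∀ i, constantCoeff (f i) = 0) {lam : Fin n → ℂ}
    (hlam : IsEigenvalueList (jacobianAtZero f) lam) (hres : NonResonant lam)
    {α : FSeries 𝕂 n} (hα : constantCoeff α = 0) : ∃ β, lieDerivative f β = α := by
  let _ : Algebra 𝕂 ℂ := (toComplexHom 𝕂).toAlgebra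
  refine exists_lieDerivative_eq_of_map (L := ℂ) ?_
  have hF : ∀ i, map (algebraMap 𝕂 ℂ) (f i) ∈ orderGE (Fin n) ℂ 1 := fun i =>
    mem_orderGE_one.2 (by rw [constantCoeff_map, hf0, map_zero])
  have hlin : linearPart (fun i => map (algebraMap 𝕂 ℂ) (f i)) =
      (jacobianAtZero f).map (toComplexHom 𝕂) := by
    ext1 i j
    simp only [linearPart, jacobianAtZero, Matrix.of_apply, Matrix.map_apply, ← map_pderiv,
      constantCoeff_map]
    rfl
  refine exists_lieDerivative_eq hF (fun k hk φ hφ => exists_sub_lieDerivative_mem hF ?_ hk hφ)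
    (by rw [constantCoeff_map, hα, map_zero])
  intro s hs hev
  rw [hlin] at hev
  exact hres.multiset_sum_ne_zero hs fun μ hμ => hlam.exists_eq_of_hasEigenvalue (hev μ hμ)

end NonResonance

end FormalNF

theorem proposition4p18 {𝕂 : Type*} [RCLike 𝕂] {n : ℕ}
    (f : FormalNF.FVectorField 𝕂 n)
    (hf0 : ∀ i, MvPowerSeries.constantCoeff (f i) = 0)
    (lam : Fin n → ℂ)
    (hlam : FormalNF.IsEigenvalueList (FormalNF.jacobianAtZero f) lam)
    (hres : FormalNF.NonResonant lam)
    (g : FormalNF.FVectorField 𝕂 n) (α : FormalNF.FSeries 𝕂 n)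
    (hg : FormalNF.lieBracket g f = α • f) :
    ∃ (h : FormalNF.FVectorField 𝕂 n) (β : FormalNF.FSeries 𝕂 n),
      g = h + β • f ∧ FormalNF.lieBracket h f = 0 := by
  rcases Nat.eq_zero_or_pos n with rfl | hn
  · exact ⟨g, 0, Subsingleton.elim _ _, Subsingleton.elim _ _⟩
  have : NeZero n := ⟨hn.ne'⟩
  have hα := FormalNF.constantCoeff_eq_zero_of_lieBracket_eq_smul hf0
    (hlam.det_ne_zero hres) hg
  obtain ⟨β, hβ⟩ := FormalNF.exists_lieDerivative_eq_of_nonResonant hf0 hlam hres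
    (α := -α) (by rw [map_neg, hα, neg_zero])
  refine ⟨g - β • f, β, (sub_add_cancel g _).symm, ?_⟩
  rw [FormalNF.lieBracket_sub_smul, hg, hβ, neg_smul, add_neg_cancel]
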